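/- Let $E$ be a Polish space with Borel $\sigma$-algebra $\mathcal E$, and let $d$ be a bounded metric on $E$ which is continuous on $E\times E$ with respect to the Polish topology ($d$ need not be complete and need not generate that topology). Let $X=(X_n)_{n\ge 0}$ be a Markov chain on $E$ with transition kernel $P$ and $n$-step transition kernels $P_n$. For a probability measure $\nu$ on $E$ let $\mathbb P_\nu$ be the law of the chain on $E^{\infty}=E^{\{0,1,2,\dots\}}$ with initial distribution $\nu$, and put $\mathbb P_x=\mathbb P_{\delta_x}$. Assume that $X$ is $d$-Feller: for each bounded $d$-continuous $f:E\to\mathbb R$ the map $x\mapsto\int f(y)\,P(x,\mathrm dy)$ is $d$-continuous. For probability measures $\mathbb P,\mathbb Q$ on $E^\infty$ let $\widehat C(\mathbb P,\mathbb Q)$ be the set of generalized couplings, i.e. of the probability measures $\xi$ on $E^\infty\times E^\infty$ whose first and second marginals satisfy $\pi_1(\xi)\ll\mathbb P$ and $\pi_2(\xi)\ll\mathbb Q$; write $(X_n)$, $(Y_n)$ for the two coordinate sequences on $E^\infty\times E^\infty$. For probability measures $\nu_1,\nu_2$ on $E$ put $d(\nu_1,\nu_2)=\inf_\eta\int_{E\times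 E} d(u,v)\,\eta(\mathrm du,\mathrm dv)$, the infimum being over all couplings $\eta$ of $\nu_1$ and $\nu_2$ (probability measures on $E\times E$ with marginals $\nu_1$ and $\nu_2$). Let $\mu$ be an ergodic invariant probability measure, i.e. $\int_E P(x,\cdot)\,\mu(\mathrm dx)=\mu$ and the left shift on $E^\infty$ is ergodic with respect to $\mathbb P_\mu$. Let $M\in\mathcal E\otimes\mathcal E$ satisfy $(\mu\otimes\mu)(M)=1$, and suppose that for each $(x,y)\in M$ there exist $\xi_{x,y}\in\widehat C(\mathbb P_x,\mathbb P_y)$ and $\alpha_{x,y}>0$ such that $$\liminf_{n\to\infty}\xi_{x,y}\big(d(X_n,Y_n)\le\varepsilon\big)\ge\alpha_{x,y}\qquad\text{for every }\varepsilon>0.$$ Then $P_n(x,\cdot)$ converges weakly to $\mu$ with respect to $d$, in $\mu$-probability; precisely, for every $\varepsilon>0$, $$\mu\big(\{x\in E: d(P_n(x,\cdot),\mu)>\varepsilon\}\big)\to 0\qquad(n\to\infty).$$ -/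

import Mathlib

open MeasureTheory ProbabilityTheory Filter Topology
open scoped ENNReal

noncomputable section

namespace GenCoupling

/-- `d` is a metric on the set `E` which is bounded and (jointly) continuous with respect to the
given topology of `E`. It need not generate that topology and need not be complete. -/
structure IsBoundedContinuousMetric {E : Type*} [TopologicalSpace E] (d : E → E → ℝ) : Prop where
  eq_zero_iff : ∀ x y, d x y = 0 ↔ x = y
  symm : ∀ x y, d x y = d y x
  triangle : ∀ x y z, d x z ≤ d x y + d y z
  bounded : ∃ C : ℝ, ∀ x y, d x y ≤ C
  continuous : Continuous fun p : E × E => d p.1 p.2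

/-- Continuity of a real function with respect to the metric `d`. -/
def DContinuous {E : Type*} (d : E → E → ℝ) (f : E → ℝ) : Prop :=
  ∀ x, ∀ ε > (0 : ℝ), ∃ δ > (0 : ℝ), ∀ y, d x y < δ → |f y - f x| < ε

/-- The chain with transition kernel `P` is `d`-Feller: `P` maps bounded `d`-continuous functions
to `d`-continuous functions. -/
def DFeller {E : Type*} [MeasurableSpace E] (d : E → E → ℝ) (P : Kernel E E) : Prop :=
  ∀ f : E → ℝ, (∃ C : ℝ, ∀ x, |f x| ≤ C) → DContinuous d f →
    DContinuous d fun x => ∫ y, f y ∂(P x)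

/-- The one-step transition kernel `P`, read as a kernel which gives the conditional law of
`X (n + 1)` given the history `X 0, …, X n`: it depends only on `X n`. -/
def historyKernel {E : Type*} [MeasurableSpace E] (P : Kernel E E) (n : ℕ) :
    Kernel (Finset.Iic n → E) E :=
  P.comap (fun h => h ⟨n, Finset.mem_Iic.2 le_rfl⟩) (measurable_pi_apply _)

instance {E : Type*} [MeasurableSpace E] (P : Kernel E E) [IsMarkovKernel P] (n : ℕ) :
    IsMarkovKernel (historyKernel P n) := by
  unfold historyKernel
  infer_instance

/-- The law on the trajectory space `ℕ → E` of the Markov chain with transition kernel `P` and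
initial distribution `μ` (through the Ionescu-Tulcea theorem). -/
def chainLaw {E : Type*} [MeasurableSpace E] (P : Kernel E E) [IsMarkovKernel P]
    (μ : Measure E) [IsProbabilityMeasure μ] : Measure (ℕ → E) :=
  Kernel.trajMeasure (X := fun _ : ℕ => E) μ (historyKernel P)

/-- The left shift on trajectories. -/
def shift {E : Type*} (x : ℕ → E) : ℕ → E := fun n => x (n + 1)

/-- `μ` is an ergodic invariant probability measure: it is invariant for `P`, and the left shift
is ergodic with respect to the law of the chain started from `μ`. -/
def IsErgodicInvariant {E : Type*} [MeasurableSpace E] (P : Kernel E E) [IsMarkovKernel P]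
    (μ : Measure E) [IsProbabilityMeasure μ] : Prop :=
  Kernel.Invariant P μ ∧ Ergodic shift (chainLaw P μ)

/-- The couplings of two measures. -/
def couplings {S : Type*} [MeasurableSpace S] (μ ν : Measure S) : Set (Measure (S × S)) :=
  {ξ | IsProbabilityMeasure ξ ∧ ξ.map Prod.fst = μ ∧ ξ.map Prod.snd = ν}

/-- The generalized couplings of two measures: the marginals are only required to be absolutely
continuous. -/
def generalizedCouplings {S : Type*} [MeasurableSpace S] (μ ν : Measure S) :
    Set (Measure (S × S)) :=
  {ξ | IsProbabilityMeasure ξ ∧ ξ.map Prod.fst ≪ μ ∧ ξ.map Prod.snd ≪ ν}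

/-- The minimal (coupling, Kantorovich-Rubinshtein) distance of two probability measures
associated with `d`. -/
def couplingDist {E : Type*} [MeasurableSpace E] (d : E → E → ℝ) (μ ν : Measure E) : ℝ≥0∞ :=
  ⨅ η ∈ couplings μ ν, ∫⁻ p, ENNReal.ofReal (d p.1 p.2) ∂η

end GenCoupling

end

namespace GenCoupling

/-! For bounded `d`-continuous `f`, stationarity makes `∫ (P ^ n f)² dμ` nonincreasing, and its
decrement from `m` to `m + k` is the mean variance of `P ^ m f` under `P ^ k x`
(`integral_integral_sq_sub_transitionMean`). For `m` large this is small for all `k` at once, so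
from most `x` the value of `P ^ m f` at time `k` is nearly the constant `P ^ (m + k) f x`
(`exists_transitionMean_concentrated`).

A generalized coupling cannot be used to compare laws, but absolute continuity keeps events of small
probability small. Hence outside the bad events of both chains there are points `u`, `v` with `d u
v` small (`exists_close_of_generalizedCoupling`). The Feller property and tightness of `μ` give `P ^
m f u ≈ P ^ m f v`, so `P ^ (m + k) f` nearly agrees at most pairs of starting points. Its variance
under `μ` is then small at one time, and by monotonicity at all later ones
(`tendsto_measure_transitionMean_sub`).

Finitely many test functions forming a partition of unity control the coupling distance
(`couplingDist_le_of_partition`). -/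

lemma kernel_pow_zero_apply {E : Type*} [MeasurableSpace E] (P : Kernel E E) (x : E) :
    (P ^ 0) x = Measure.dirac x :=
  Kernel.id_apply x

/-! ### One-dimensional marginals of the chain law. -/

section ChainLaw

variable {E : Type*} [MeasurableSpace E] (P : Kernel E E) [IsMarkovKernel P]

instance (μ : Measure E) [IsProbabilityMeasure μ] : IsProbabilityMeasure (chainLaw P μ) := by
  unfold chainLaw
  infer_instance

instance isMarkovKernel_pow (n : ℕ) : IsMarkovKernel (P ^ n) := by
  induction n with
  | zero => exact inferInstanceAs (IsMarkovKernel (Kernel.id : Kernel E E))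
  | succ n ih =>
    rw [Kernel.pow_add]
    rw [pow_one]
    infer_instance

lemma map_eval_zero_chainLaw (μ : Measure E) [IsProbabilityMeasure μ] :
    (chainLaw P μ).map (fun z => z 0) = μ := by
  have h : (fun z : ℕ → E => z 0) =
      (fun w : Finset.Iic 0 → E => w ⟨0, Finset.mem_Iic.2 le_rfl⟩) ∘
        Preorder.frestrictLe (π := fun _ : ℕ => E) 0 := rfl
  rw [h, ← Measure.map_map (by fun_prop) (by fun_prop), chainLaw, Kernel.trajMeasure,
    Measure.map_comp _ _ (by fun_prop), Kernel.traj_map_frestrictLe, Kernel.partialTraj_self,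
    Measure.id_comp, Measure.map_map (by fun_prop) (by fun_prop)]
  exact Measure.map_id

lemma map_eval_chainLaw_dirac (x : E) (n : ℕ) :
    (chainLaw P (Measure.dirac x)).map (fun z => z n) = (P ^ n) x := by
  induction n with
  | zero => rw [map_eval_zero_chainLaw, kernel_pow_zero_apply]
  | succ n ih =>
    ext A hA
    -- The history up to `n` together with the next state has law `history ⊗ historyKernel`; its
    -- last marginal is one Markov step.
    have key := Kernel.map_frestrictLe_trajMeasure_compProd_eq_map_trajMeasure
      (X := fun _ : ℕ => E) (μ₀ := Measure.dirac x) (κ := historyKernel P) (a := n)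
    have h2 := congrArg (fun ν => ν.map Prod.snd A) key
    beta_reduce at h2
    rw [Measure.map_map (by fun_prop) (by fun_prop), Measure.map_apply (by fun_prop) hA,
      Measure.compProd_apply (hA.preimage measurable_snd),
      lintegral_map (Kernel.measurable_kernel_prodMk_left (hA.preimage measurable_snd))
        (by fun_prop)] at h2
    rw [Kernel.pow_succ_apply_eq_lintegral _ _ _ hA, ← ih,
      lintegral_map (P.measurable_coe hA) (by fun_prop)]
    exact h2.symm

lemma chainLaw_dirac_eval_preimage (x : E) (n : ℕ) {A : Set E} (hA : MeasurableSet A) :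
    chainLaw P (Measure.dirac x) ((fun z => z n) ⁻¹' A) = (P ^ n) x A := by
  rw [← map_eval_chainLaw_dirac, Measure.map_apply (by fun_prop) hA]

end ChainLaw

/-! ### Absolute continuity and generalized couplings. -/

lemma exists_pos_measure_lt_of_absolutelyContinuous {α : Type*} [MeasurableSpace α]
    {μ ν : Measure α} [IsFiniteMeasure μ] [SigmaFinite ν] (h : μ ≪ ν) {ε : ℝ≥0∞} (hε : ε ≠ 0) :
    ∃ δ > 0, ∀ s, ν s < δ → μ s < ε := by
  obtain ⟨δ, hδ, H⟩ := exists_pos_setLIntegral_lt_of_measure_lt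
    (μ := ν) (f := μ.rnDeriv ν) (Measure.lintegral_rnDeriv_lt_top μ ν).ne hε
  refine ⟨δ, hδ, fun s hs => ?_⟩
  rw [← Measure.setLIntegral_rnDeriv h]
  exact H s hs

/-- If two trajectories admit a generalized coupling which brings them together with positive
asymptotic probability, then at large times they can be found close to each other while
avoiding any prescribed events of small probability. -/
lemma exists_close_of_generalizedCoupling {E : Type*} [MeasurableSpace E]
    {d : E → E → ℝ} (P : Kernel E E) [IsMarkovKernel P] {x y : E}
    {ξ : Measure ((ℕ → E) × (ℕ → E))}
    (hξ : ξ ∈ generalizedCouplings (chainLaw P (Measure.dirac x)) (chainLaw P (Measure.dirac y)))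
    {α : ℝ} (hα : 0 < α)
    (hlim : ∀ ε : ℝ, 0 < ε → ENNReal.ofReal α ≤
      liminf (fun n : ℕ => ξ {z : (ℕ → E) × (ℕ → E) | d (z.1 n) (z.2 n) ≤ ε}) atTop) :
    ∃ δ : ℝ≥0∞, 0 < δ ∧ ∀ ε : ℝ, 0 < ε → ∃ N : ℕ, ∀ k ≥ N, ∀ A B : Set E,
      MeasurableSet A → MeasurableSet B → (P ^ k) x A < δ → (P ^ k) y B < δ →
        ∃ u ∉ A, ∃ v ∉ B, d u v ≤ ε := by
  obtain ⟨hprob, h1, h2⟩ := hξ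
  -- Two bad events of `ξ`-mass below `α / 3` cannot cover an event of mass above `2α / 3`. The
  -- resulting `δ` does not depend on `ε`.
  have hα3 : ENNReal.ofReal (α / 3) ≠ 0 := by simpa using by positivity
  obtain ⟨δ₁, hδ₁, H1⟩ := exists_pos_measure_lt_of_absolutelyContinuous h1 hα3
  obtain ⟨δ₂, hδ₂, H2⟩ := exists_pos_measure_lt_of_absolutelyContinuous h2 hα3
  refine ⟨min δ₁ δ₂, lt_min hδ₁ hδ₂, fun ε hε => ?_⟩
  have hlt : ENNReal.ofReal (α / 3 + α / 3) < ENNReal.ofReal α :=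
    (ENNReal.ofReal_lt_ofReal_iff hα).2 (by linarith)
  obtain ⟨N, hN⟩ := eventually_atTop.1 (eventually_lt_of_lt_liminf (hlt.trans_le (hlim ε hε)))
  refine ⟨N, fun k hk A B hA hB hxA hyB => ?_⟩
  by_contra! hcon
  have mk : Measurable fun z : ℕ → E => z k := measurable_pi_apply k
  have hA' := H1 ((fun z => z k) ⁻¹' A)
    (by rw [chainLaw_dirac_eval_preimage P x k hA]; exact hxA.trans_le (min_le_left _ _))
  have hB' := H2 ((fun z => z k) ⁻¹' B)
    (by rw [chainLaw_dirac_eval_preimage P y k hB]; exact hyB.trans_le (min_le_right _ _))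
  rw [Measure.map_apply measurable_fst (mk hA)] at hA'
  rw [Measure.map_apply measurable_snd (mk hB)] at hB'
  refine absurd (hN k hk) (not_lt.2 ?_)
  rw [ENNReal.ofReal_add (by positivity) (by positivity)]
  refine (measure_mono fun z hz => ?_).trans
    ((measure_union_le _ _).trans (add_le_add hA'.le hB'.le))
  by_contra hnot
  simp only [Set.mem_union, Set.mem_preimage, not_or] at hnot
  exact absurd hz (not_le.2 (hcon _ hnot.1 _ hnot.2))

/-! ### Continuity with respect to `d` and partitions of unity. -/

section Metric

variable {E : Type*} [TopologicalSpace E] {d : E → E → ℝ}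

lemma IsBoundedContinuousMetric.self (hd : IsBoundedContinuousMetric d) (x : E) : d x x = 0 :=
  (hd.eq_zero_iff x x).2 rfl

lemma IsBoundedContinuousMetric.nonneg (hd : IsBoundedContinuousMetric d) (x y : E) :
    0 ≤ d x y := by
  have h := hd.triangle x y x
  rw [hd.self, hd.symm y x] at h
  linarith

lemma IsBoundedContinuousMetric.continuous_left (hd : IsBoundedContinuousMetric d) (x : E) :
    Continuous (d x) :=
  hd.continuous.comp (Continuous.prodMk_right x)

/-- The filter form makes the limit rules for sums, minima and products available without putting a
second topology on `E`. -/
lemma IsBoundedContinuousMetric.dContinuous_iff (hd : IsBoundedContinuousMetric d)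
    {f : E → ℝ} : DContinuous d f ↔ ∀ x, Tendsto f (comap (d x) (𝓝 0)) (𝓝 (f x)) := by
  refine forall_congr' fun x => ?_
  have hb := (Metric.nhds_basis_ball (x := (0 : ℝ))).comap (d x)
  rw [hb.tendsto_iff Metric.nhds_basis_ball]
  simp [Real.dist_eq, abs_of_nonneg (hd.nonneg x _)]

lemma IsBoundedContinuousMetric.continuous_of_dContinuous (hd : IsBoundedContinuousMetric d)
    {f : E → ℝ} (hf : DContinuous d f) : Continuous f := by
  refine continuous_iff_continuousAt.2 fun x => ((hd.dContinuous_iff.1 hf) x).mono_left ?_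
  have h := (hd.continuous_left x).tendsto x
  rw [hd.self] at h
  exact h.le_comap

lemma IsBoundedContinuousMetric.dContinuous_dist (hd : IsBoundedContinuousMetric d) (z : E) :
    DContinuous d (d z) := by
  refine fun x ε hε => ⟨ε, hε, fun y hy => lt_of_le_of_lt ?_ hy⟩
  have h1 := hd.triangle z x y
  have h2 := hd.triangle z y x
  rw [hd.symm y x] at h2
  exact abs_sub_le_iff.2 ⟨by linarith, by linarith⟩

/-- A `d`-continuous function is uniformly `d`-continuous on compact sets. -/
lemma IsBoundedContinuousMetric.exists_uniform_of_isCompact (hd : IsBoundedContinuousMetric d)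
    {g : E → ℝ} (hg : DContinuous d g) {K : Set E} (hK : IsCompact K) {η : ℝ} (hη : 0 < η) :
    ∃ ε > 0, ∀ u ∈ K, ∀ v ∈ K, d u v ≤ ε → |g u - g v| ≤ η := by
  have hgc := hd.continuous_of_dContinuous hg
  have hL : IsCompact ((K ×ˢ K) ∩ {p : E × E | η ≤ |g p.1 - g p.2|}) :=
    (hK.prod hK).inter_right (isClosed_le continuous_const (by fun_prop))
  rcases Set.eq_empty_or_nonempty ((K ×ˢ K) ∩ {p : E × E | η ≤ |g p.1 - g p.2|}) with h0 | hne
  · refine ⟨1, one_pos, fun u hu v hv _ => ?_⟩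
    by_contra! hlt
    have : (u, v) ∈ (K ×ˢ K) ∩ {p : E × E | η ≤ |g p.1 - g p.2|} := ⟨⟨hu, hv⟩, hlt.le⟩
    rw [h0] at this
    exact this
  -- On the compact set of pairs where `g` oscillates by at least `η`, `d` attains a minimum,
  -- positive because the diagonal is excluded; half of it serves as `ε`.
  · obtain ⟨p, hp, hmin⟩ := hL.exists_isMinOn hne hd.continuous.continuousOn
    have hpos : 0 < d p.1 p.2 := by
      refine lt_of_le_of_ne (hd.nonneg _ _) fun h => ?_
      have h2 := hp.2
      rw [Set.mem_ofPred_eq, (hd.eq_zero_iff _ _).1 h.symm, sub_self, abs_zero] at h2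
      linarith
    refine ⟨d p.1 p.2 / 2, by positivity, fun u hu v hv huv => ?_⟩
    by_contra! hlt
    have h := isMinOn_iff.1 hmin (u, v) ⟨⟨hu, hv⟩, hlt.le⟩
    simp only at h
    linarith

/-- Up to small `μ`-mass, `E` carries a finite partition of unity consisting of `d`-continuous
functions supported in small `d`-balls. -/
lemma IsBoundedContinuousMetric.exists_partition [TopologicalSpace.SeparableSpace E]
    [MeasurableSpace E] [BorelSpace E] (hd : IsBoundedContinuousMetric d)
    (μ : Measure E) [IsProbabilityMeasure μ] {ε : ℝ} (hε : 0 < ε) {δ : ℝ} (hδ : 0 < δ) :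
    ∃ (r : ℕ) (z : ℕ → E) (φ : ℕ → E → ℝ), (∀ i x, 0 ≤ φ i x) ∧ (∀ i x, φ i x ≤ 1) ∧
      (∀ i, DContinuous d (φ i)) ∧ (∀ x, ∑ i ∈ Finset.range r, φ i x ≤ 1) ∧
      (∀ i x, φ i x ≠ 0 → d (z i) x ≤ ε) ∧ 1 - δ ≤ ∑ i ∈ Finset.range r, ∫ x, φ i x ∂μ := by
  have : Nonempty E := nonempty_of_isProbabilityMeasure μ
  set z := TopologicalSpace.denseSeq E
  -- The factor 2 makes the bump at least 1 on the ball of radius `ε / 2`, so the truncated sums `S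
  -- r` increase to 1 everywhere. Their increments are the partition.
  let ψ : ℕ → E → ℝ := fun i x => 2 * max (1 - d (z i) x / ε) 0
  let S : ℕ → E → ℝ := fun r x => min (∑ i ∈ Finset.range r, ψ i x) 1
  have hψ0 : ∀ i x, 0 ≤ ψ i x := fun i x => by positivity
  have hsum0 : ∀ r x, 0 ≤ ∑ i ∈ Finset.range r, ψ i x :=
    fun r x => Finset.sum_nonneg fun i _ => hψ0 i x
  have hS0 : ∀ r x, 0 ≤ S r x := fun r x => le_min (hsum0 r x) zero_le_one
  have hS1 : ∀ r x, S r x ≤ 1 := fun r x => min_le_right _ _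
  have hSs : ∀ i x, S i x ≤ S (i + 1) x := fun i x =>
    min_le_min_right _ (by rw [Finset.sum_range_succ]; linarith [hψ0 i x])
  have hSz : ∀ x, S 0 x = 0 := fun x => by simp [S]
  have hSd : ∀ r, DContinuous d (S r) := by
    refine fun r => hd.dContinuous_iff.2 fun x => ?_
    refine (tendsto_finsetSum _ fun i _ => ?_).min tendsto_const_nhds
    have := hd.dContinuous_iff.1 (hd.dContinuous_dist (z i)) x
    exact (((this.div_const ε).const_sub 1).max tendsto_const_nhds).const_mul 2
  have hSc : ∀ r, Continuous (S r) := fun r => hd.continuous_of_dContinuous (hSd r)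
  have hSint : ∀ r, Integrable (S r) μ := fun r =>
    Integrable.of_bound (hSc r).measurable.aestronglyMeasurable 1
      (ae_of_all _ fun x => by rw [Real.norm_eq_abs, abs_of_nonneg (hS0 r x)]; exact hS1 r x)
  have htel : ∀ r x, ∑ i ∈ Finset.range r, (S (i + 1) x - S i x) = S r x := fun r x => by
    rw [Finset.sum_range_sub (fun i => S i x), hSz, sub_zero]
  have hlim : Tendsto (fun r => ∫ x, S r x ∂μ) atTop (𝓝 (∫ _, (1 : ℝ) ∂μ)) := by
    refine tendsto_integral_of_dominated_convergence (fun _ => 1)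
      (fun r => (hSint r).aestronglyMeasurable) (integrable_const _)
      (fun r => ae_of_all _ fun x => ?_) (ae_of_all _ fun x => ?_)
    · rw [Real.norm_eq_abs, abs_of_nonneg (hS0 r x)]
      exact hS1 r x
    · have hop : IsOpen {y | d x y < ε / 2} := isOpen_lt (hd.continuous_left x) continuous_const
      obtain ⟨i, hi⟩ := (TopologicalSpace.denseRange_denseSeq E).exists_mem_open hop
        ⟨x, by simp only [Set.mem_ofPred_eq, hd.self]; positivity⟩
      refine tendsto_atTop_of_eventually_const (i₀ := i + 1) fun r hr => ?_
      refine min_eq_right ?_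
      have hle := Finset.single_le_sum (f := fun i => ψ i x) (fun j _ => hψ0 j x)
        (Finset.mem_range.2 hr)
      refine le_trans ?_ hle
      have h1 : d (z i) x / ε ≤ 1 / 2 := by
        rw [div_le_iff₀ hε, hd.symm]
        have : d x (z i) < ε / 2 := hi
        linarith
      have := le_max_left (1 - d (z i) x / ε) 0
      simp only [ψ]
      linarith
  rw [integral_const, probReal_univ, one_smul] at hlim
  obtain ⟨r, hr⟩ := (hlim.eventually (lt_mem_nhds (show 1 - δ < 1 by linarith))).exists
  refine ⟨r, z, fun i x => S (i + 1) x - S i x, fun i x => sub_nonneg.2 (hSs i x),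
    fun i x => by linarith [hS1 (i + 1) x, hS0 i x], fun i => ?_, fun x => ?_, fun i x h => ?_, ?_⟩
  · exact hd.dContinuous_iff.2 fun x => (hd.dContinuous_iff.1 (hSd (i + 1)) x).sub
      (hd.dContinuous_iff.1 (hSd i) x)
  · rw [htel]
    exact hS1 r x
  · by_contra! hlt
    refine h (sub_eq_zero.2 ?_)
    have h1 : ψ i x = 0 := by
      have : 1 - d (z i) x / ε ≤ 0 := by
        rw [sub_nonpos, le_div_iff₀ hε]
        linarith
      simp only [ψ]
      rw [max_eq_right this, mul_zero]
    simp only [S]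
    rw [Finset.sum_range_succ, h1, add_zero]
  · beta_reduce
    rw [← integral_finsetSum (f := fun i x => S (i + 1) x - S i x) _
      fun i _ => (hSint (i + 1)).sub (hSint i)]
    simp_rw [htel]
    exact hr.le

end Metric

/-! ### Assembling couplings from pieces of equal mass. -/

section Coupling

variable {S : Type*} [MeasurableSpace S]

/-- The finite measures `α` and `β` are the marginals of a measure on the product for which the
total cost is at most `K`. -/
def HasCouplingCostLE (c : S × S → ℝ≥0∞) (α β : Measure S) (K : ℝ≥0∞) : Prop :=
  ∃ η : Measure (S × S), η.map Prod.fst = α ∧ η.map Prod.snd = β ∧ ∫⁻ p, c p ∂η ≤ K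

lemma HasCouplingCostLE.add {c : S × S → ℝ≥0∞} {α β α' β' : Measure S} {K K' : ℝ≥0∞}
    (h : HasCouplingCostLE c α β K) (h' : HasCouplingCostLE c α' β' K') :
    HasCouplingCostLE c (α + α') (β + β') (K + K') := by
  obtain ⟨η, h1, h2, h3⟩ := h
  obtain ⟨η', h1', h2', h3'⟩ := h'
  refine ⟨η + η', ?_, ?_, ?_⟩
  · rw [Measure.map_add _ _ measurable_fst, h1, h1']
  · rw [Measure.map_add _ _ measurable_snd, h2, h2']
  · rw [lintegral_add_measure]
    gcongr

lemma HasCouplingCostLE.sum {ι : Type*} {c : S × S → ℝ≥0∞} {α β : ι → Measure S}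
    {K : ι → ℝ≥0∞} (s : Finset ι) (h : ∀ i ∈ s, HasCouplingCostLE c (α i) (β i) (K i)) :
    HasCouplingCostLE c (∑ i ∈ s, α i) (∑ i ∈ s, β i) (∑ i ∈ s, K i) := by
  classical
  induction s using Finset.induction_on with
  | empty => exact ⟨0, by simp, by simp, by simp⟩
  | insert i s hi ih =>
    rw [Finset.sum_insert hi, Finset.sum_insert hi, Finset.sum_insert hi]
    exact (h i (Finset.mem_insert_self i s)).add
      (ih fun j hj => h j (Finset.mem_insert_of_mem hj))

/-- The product measure divided by the common mass has the right marginals; mass zero is treated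
apart. -/
lemma hasCouplingCostLE_prod {c : S × S → ℝ≥0∞} {α β : Measure S} [IsFiniteMeasure α]
    [IsFiniteMeasure β] (hmass : α Set.univ = β Set.univ) {D : ℝ≥0∞}
    (hc : ∀ᵐ p ∂α.prod β, c p ≤ D) : HasCouplingCostLE c α β (D * α Set.univ) := by
  rcases eq_or_ne (α Set.univ) 0 with h0 | h0
  · have hα := Measure.measure_univ_eq_zero.1 h0
    have hβ := Measure.measure_univ_eq_zero.1 (hmass ▸ h0)
    exact ⟨0, by simp [hα], by simp [hβ], by simp⟩
  · have ht : α Set.univ ≠ ∞ := measure_ne_top _ _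
    refine ⟨(α Set.univ)⁻¹ • α.prod β, ?_, ?_, ?_⟩
    · rw [Measure.map_smul, Measure.map_fst_prod, ← hmass, smul_smul,
        ENNReal.inv_mul_cancel h0 ht, one_smul]
    · rw [Measure.map_smul, Measure.map_snd_prod, smul_smul,
        ENNReal.inv_mul_cancel h0 ht, one_smul]
    · rw [lintegral_smul_measure, smul_eq_mul]
      calc (α Set.univ)⁻¹ * ∫⁻ p, c p ∂α.prod β
          ≤ (α Set.univ)⁻¹ * ∫⁻ _, D ∂α.prod β := by gcongr 1; exact lintegral_mono_ae hc
        _ = D * α Set.univ * ((α Set.univ)⁻¹ * α Set.univ) := by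
          rw [lintegral_const, ← Set.univ_prod_univ, Measure.prod_prod, ← hmass]
          ring
        _ ≤ D * α Set.univ := by rw [ENNReal.inv_mul_cancel h0 ht, mul_one]

lemma sum_withDensity {ι : Type*} (μ : Measure S) (g : ι → S → ℝ≥0∞) (s : Finset ι)
    (hg : ∀ i ∈ s, Measurable (g i)) :
    ∑ i ∈ s, μ.withDensity (g i) = μ.withDensity (fun x => ∑ i ∈ s, g i x) := by
  classical
  induction s using Finset.induction_on with
  | empty => simp
  | insert i s hi ih =>
    rw [Finset.sum_insert hi, ih fun j hj => hg j (Finset.mem_insert_of_mem hj),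
      ← withDensity_add_left (hg i (Finset.mem_insert_self i s))]
    congr 1
    ext x
    simp [Finset.sum_insert hi]

lemma sum_withDensity_add_compl {ι : Type*} (μ : Measure S) (g : ι → S → ℝ≥0∞) (s : Finset ι)
    (hg : ∀ i ∈ s, Measurable (g i)) (h1 : ∀ x, ∑ i ∈ s, g i x ≤ 1) :
    (∑ i ∈ s, μ.withDensity (g i)) + μ.withDensity (fun x => 1 - ∑ i ∈ s, g i x) = μ := by
  rw [sum_withDensity μ g s hg, ← withDensity_add_left (Finset.measurable_fun_sum s hg)]
  have : ((fun x => ∑ i ∈ s, g i x) + fun x => 1 - ∑ i ∈ s, g i x) = 1 := by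
    ext x
    exact add_tsub_cancel_of_le (h1 x)
  rw [this, withDensity_one]

/-- The coupling distance of two probability measures is small as soon as they give almost the
same mass to the functions of a partition of unity with small supports. -/
lemma couplingDist_le_of_partition {d : S → S → ℝ} (hsymm : ∀ x y, d x y = d y x)
    (htri : ∀ x y z, d x z ≤ d x y + d y z) {C : ℝ} (hC : ∀ x y, d x y ≤ C)
    (ν μ : Measure S) [IsProbabilityMeasure ν] [IsProbabilityMeasure μ]
    {ι : Type*} (s : Finset ι) (z : ι → S) (φ : ι → S → ℝ≥0∞) (hφ : ∀ i, Measurable (φ i))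
    (hsum : ∀ x, ∑ i ∈ s, φ i x ≤ 1) {ε : ℝ}
    (hsupp : ∀ i x, φ i x ≠ 0 → d (z i) x ≤ ε) :
    couplingDist d ν μ ≤ ENNReal.ofReal (2 * ε) +
      ENNReal.ofReal C * (1 - ∑ i ∈ s, min (∫⁻ x, φ i x ∂ν) (∫⁻ x, φ i x ∂μ)) := by
  set m : ι → ℝ≥0∞ := fun i => min (∫⁻ x, φ i x ∂ν) (∫⁻ x, φ i x ∂μ) with hm
  -- Each measure is cut into localized pieces, scaled down to the common masses `m i`, plus a
  -- remainder.
  have piece : ∀ ρ : Measure S, IsProbabilityMeasure ρ → (∀ i, m i ≤ ∫⁻ x, φ i x ∂ρ) →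
      ∃ α : ι → Measure S, ∃ α₀ : Measure S, (∑ i ∈ s, α i) + α₀ = ρ ∧
        (∀ i ∈ s, α i Set.univ = m i) ∧ ∀ i ∈ s, ∀ᵐ x ∂α i, d (z i) x ≤ ε := by
    intro ρ hρ hmρ
    let t : ι → ℝ≥0∞ := fun i => m i / ∫⁻ x, φ i x ∂ρ
    have ht : ∀ i, t i ≤ 1 := fun i => ENNReal.div_le_of_le_mul (by rw [one_mul]; exact hmρ i)
    refine ⟨fun i => ρ.withDensity fun x => t i * φ i x,
      ρ.withDensity fun x => 1 - ∑ i ∈ s, t i * φ i x, ?_, fun i hi => ?_, fun i hi => ?_⟩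
    · refine sum_withDensity_add_compl ρ _ s (fun i _ => (hφ i).const_mul _) fun x => ?_
      refine (Finset.sum_le_sum fun i _ => ?_).trans (hsum x)
      exact mul_le_of_le_one_left' (ht i)
    · rw [withDensity_apply _ MeasurableSet.univ, setLIntegral_univ, lintegral_const_mul _ (hφ i)]
      have hfin : ∫⁻ x, φ i x ∂ρ ≠ ∞ := by
        refine ne_top_of_le_ne_top ENNReal.one_ne_top ?_
        calc ∫⁻ x, φ i x ∂ρ ≤ ∫⁻ _, 1 ∂ρ := lintegral_mono fun x =>
              (Finset.single_le_sum (f := fun i => φ i x) (fun _ _ => zero_le) hi).trans (hsum x)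
          _ = 1 := by simp
      rcases eq_or_ne (∫⁻ x, φ i x ∂ρ) 0 with h0 | h0
      · have h := hmρ i
        rw [h0, nonpos_iff_eq_zero] at h
        rw [h0, mul_zero, h]
      · exact ENNReal.div_mul_cancel h0 hfin
    · rw [ae_withDensity_iff' ((hφ i).const_mul _).aemeasurable]
      exact ae_of_all _ fun x hx => hsupp i x fun h => hx (by rw [h, mul_zero])
  obtain ⟨α, α₀, hα, hαm, hαd⟩ := piece ν inferInstance fun i => min_le_left _ _
  obtain ⟨β, β₀, hβ, hβm, hβd⟩ := piece μ inferInstance fun i => min_le_right _ _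
  have mass : ∀ (γ : ι → Measure S) (γ₀ ρ : Measure S), IsProbabilityMeasure ρ →
      (∑ i ∈ s, γ i) + γ₀ = ρ → (∀ i ∈ s, γ i Set.univ = m i) →
      γ₀ Set.univ = 1 - ∑ i ∈ s, m i ∧ ∑ i ∈ s, m i ≤ 1 ∧ IsFiniteMeasure γ₀ ∧
        ∀ i ∈ s, IsFiniteMeasure (γ i) := by
    intro γ γ₀ ρ hρ hsumρ hγ
    have h := congrArg (fun κ : Measure S => κ Set.univ) hsumρ
    simp only [Measure.add_apply, Measure.finsetSum_apply, measure_univ,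
      Finset.sum_congr rfl hγ] at h
    have hle : ∑ i ∈ s, m i ≤ 1 := h ▸ le_self_add
    have hle' : γ₀ Set.univ ≤ 1 := h ▸ le_add_self
    refine ⟨ENNReal.eq_sub_of_add_eq' ENNReal.one_ne_top (by rw [add_comm]; exact h), hle,
      ⟨hle'.trans_lt ENNReal.one_lt_top⟩, fun i hi => ⟨?_⟩⟩
    rw [hγ i hi]
    exact ((Finset.single_le_sum (f := m) (fun _ _ => zero_le) hi).trans hle).trans_lt
      ENNReal.one_lt_top
  obtain ⟨hα₀, hle, hα₀f, hαf⟩ := mass α α₀ ν inferInstance hα hαm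
  obtain ⟨hβ₀, -, hβ₀f, hβf⟩ := mass β β₀ μ inferInstance hβ hβm
  -- Matched pieces cost at most `2ε` per unit mass, by the triangle inequality through `z i`; the
  -- remainders cost at most `C`.
  have key := (HasCouplingCostLE.sum (c := fun p => ENNReal.ofReal (d p.1 p.2)) (α := α) (β := β)
    (K := fun i => ENNReal.ofReal (2 * ε) * α i Set.univ) s fun i hi => by
      have := hαf i hi
      have := hβf i hi
      refine hasCouplingCostLE_prod ((hαm i hi).trans (hβm i hi).symm) ?_
      filter_upwards [Measure.quasiMeasurePreserving_fst.ae (hαd i hi),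
        Measure.quasiMeasurePreserving_snd.ae (hβd i hi)] with p h1 h2
      refine ENNReal.ofReal_le_ofReal ?_
      have := htri p.1 (z i) p.2
      rw [hsymm p.1 (z i)] at this
      linarith).add
    (hasCouplingCostLE_prod (c := fun p => ENNReal.ofReal (d p.1 p.2)) (hα₀.trans hβ₀.symm)
      (D := ENNReal.ofReal C) (ae_of_all _ fun p => ENNReal.ofReal_le_ofReal (hC _ _)))
  rw [hα, hβ, hα₀, ← Finset.mul_sum, Finset.sum_congr rfl hαm] at key
  obtain ⟨η, h1, h2, h3⟩ := key
  have hη : IsProbabilityMeasure η := by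
    refine ⟨?_⟩
    rw [← Set.preimage_univ (f := Prod.fst), ← Measure.map_apply measurable_fst MeasurableSet.univ,
      h1, measure_univ]
  refine (iInf₂_le η ⟨hη, h1, h2⟩).trans (h3.trans ?_)
  gcongr
  exact mul_le_of_le_one_right' hle

end Coupling

/-! ### Second moments of transition means. -/

lemma measure_lt_abs_le {α : Type*} [MeasurableSpace α] (ν : Measure α) [IsFiniteMeasure ν]
    {g : α → ℝ} (hg : Integrable (fun x => g x ^ 2) ν) {η : ℝ} (hη : 0 < η) :
    ν {x | η < |g x|} ≤ ENNReal.ofReal ((∫ x, g x ^ 2 ∂ν) / η ^ 2) := by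
  have h := mul_meas_ge_le_integral_of_nonneg (ae_of_all ν fun x => sq_nonneg (g x)) hg (η ^ 2)
  rw [← ofReal_measureReal]
  refine ENNReal.ofReal_le_ofReal ?_
  rw [le_div_iff₀' (by positivity)]
  refine le_trans (mul_le_mul_of_nonneg_left (measureReal_mono fun x hx => ?_) (sq_nonneg η)) h
  have hx' : η < |g x| := hx
  rw [Set.mem_ofPred_eq, ← sq_abs (g x)]
  exact pow_le_pow_left₀ hη.le hx'.le 2

section Mean

variable {E : Type*} [MeasurableSpace E]

/-- The mean of `f` under the `n`-step transition probabilities. -/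
noncomputable def transitionMean (P : Kernel E E) (f : E → ℝ) (n : ℕ) (x : E) : ℝ :=
  ∫ y, f y ∂((P ^ n) x)

lemma integrable_of_abs_le {ν : Measure E} [IsFiniteMeasure ν] {f : E → ℝ}
    (hf : Measurable f) {C : ℝ} (hC : ∀ x, |f x| ≤ C) : Integrable f ν :=
  Integrable.of_bound hf.aestronglyMeasurable C (ae_of_all _ hC)

lemma measurable_transitionMean (P : Kernel E E) {f : E → ℝ} (hf : Measurable f) (n : ℕ) :
    Measurable (transitionMean P f n) :=
  (hf.stronglyMeasurable.integral_kernel (κ := P ^ n)).measurable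

lemma invariant_pow {P : Kernel E E} {μ : Measure E} (hμ : Kernel.Invariant P μ) (k : ℕ) : Kernel.Invariant (P ^ k) μ := by
  induction k with
  | zero => exact Measure.id_comp
  | succ k ih =>
    rw [Kernel.pow_add, pow_one]
    exact ih.comp hμ

lemma integral_sub_const_sq {ν : Measure E} [IsProbabilityMeasure ν] {g : E → ℝ}
    (hg : Measurable g) {C : ℝ} (hC : ∀ x, |g x| ≤ C) (b : ℝ) :
    ∫ u, (g u - b) ^ 2 ∂ν = ∫ u, g u ^ 2 ∂ν - 2 * b * ∫ u, g u ∂ν + b ^ 2 := by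
  have i1 : Integrable (fun u => 2 * b * g u) ν := (integrable_of_abs_le hg hC).const_mul _
  have i2 : Integrable (fun u => g u ^ 2) ν :=
    integrable_of_abs_le (C := C ^ 2) (hg.pow_const 2) fun u => by
      rw [abs_pow]
      exact pow_le_pow_left₀ (abs_nonneg _) (hC u) 2
  have e : (fun u => (g u - b) ^ 2) = fun u => (g u ^ 2 - 2 * b * g u) + b ^ 2 := by
    ext u
    ring
  have i3 : Integrable (fun u => g u ^ 2 - 2 * b * g u) ν := i2.sub i1
  rw [e, integral_add i3 (integrable_const _), integral_sub i2 i1, integral_const_mul,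
    integral_const, probReal_univ, one_smul]

variable (P : Kernel E E) [IsMarkovKernel P]

lemma abs_transitionMean_le {f : E → ℝ} {C : ℝ} (hC : ∀ x, |f x| ≤ C) (n : ℕ) (x : E) :
    |transitionMean P f n x| ≤ C := by
  have h := norm_integral_le_of_norm_le_const (μ := (P ^ n) x) (f := f) (C := C) (ae_of_all _ hC)
  rwa [probReal_univ, mul_one] at h

lemma transitionMean_add {f : E → ℝ} (hf : Measurable f) {C : ℝ} (hC : ∀ x, |f x| ≤ C)
    (m k : ℕ) (x : E) :
    transitionMean P f (m + k) x = ∫ u, transitionMean P f m u ∂((P ^ k) x) := by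
  unfold transitionMean
  rw [Kernel.pow_add]
  exact Kernel.integral_comp (integrable_of_abs_le hf hC)

lemma dContinuous_transitionMean {d : E → E → ℝ} (hP : DFeller d P) {f : E → ℝ}
    (hf : Measurable f) {C : ℝ} (hC : ∀ x, |f x| ≤ C) (hfd : DContinuous d f) (n : ℕ) :
    DContinuous d (transitionMean P f n) := by
  induction n with
  | zero =>
    have h : transitionMean P f 0 = f := by
      ext x
      unfold transitionMean
      rw [kernel_pow_zero_apply, integral_dirac' _ _ hf.stronglyMeasurable]
    rwa [h]
  | succ n ih =>
    have h : transitionMean P f (n + 1) = fun x => ∫ u, transitionMean P f n u ∂(P x) := by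
      ext x
      rw [transitionMean_add P hf hC, pow_one]
    rw [h]
    exact hP _ ⟨C, abs_transitionMean_le P hC n⟩ ih

variable {P} {μ : Measure E} [IsProbabilityMeasure μ]

lemma integral_transitionMean (hμ : Kernel.Invariant P μ) {f : E → ℝ} (hf : Measurable f)
    {C : ℝ} (hC : ∀ x, |f x| ≤ C) (k : ℕ) :
    ∫ x, transitionMean P f k x ∂μ = ∫ x, f x ∂μ := by
  -- Viewing `μ` as a constant kernel turns invariance into a statement about composed kernels; the
  -- point `a` is a dummy argument.
  obtain ⟨a⟩ : Nonempty E := nonempty_of_isProbabilityMeasure μ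
  have h := Kernel.integral_comp (η := P ^ k) (κ := Kernel.const E μ) (a := a) (f := f)
    (integrable_of_abs_le hf hC)
  rw [(invariant_pow hμ k).comp_const, Kernel.const_apply] at h
  exact h.symm

/-- By Chapman–Kolmogorov the subtracted constant is the mean of `P ^ m f` under `P ^ k x`, so this
is the usual variance formula. -/
lemma integral_sq_sub_transitionMean {f : E → ℝ} (hf : Measurable f)
    {C : ℝ} (hC : ∀ x, |f x| ≤ C) (m k : ℕ) (x : E) :
    ∫ u, (transitionMean P f m u - transitionMean P f (m + k) x) ^ 2 ∂((P ^ k) x) =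
      transitionMean P (fun u => transitionMean P f m u ^ 2) k x -
        transitionMean P f (m + k) x ^ 2 := by
  have hm := measurable_transitionMean P hf m
  have hb := abs_transitionMean_le P hC m
  rw [integral_sub_const_sq hm hb, ← transitionMean_add P hf hC]
  unfold transitionMean
  ring

/-- For a stationary chain, the mean conditional variance of `P ^ m f` at time `k` is the
decrement of the second moments of `P ^ n f`. -/
lemma integral_integral_sq_sub_transitionMean (hμ : Kernel.Invariant P μ) {f : E → ℝ}
    (hf : Measurable f) {C : ℝ} (hC : ∀ x, |f x| ≤ C) (m k : ℕ) :
    Integrable (fun x => ∫ u, (transitionMean P f m u - transitionMean P f (m + k) x) ^ 2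
      ∂((P ^ k) x)) μ ∧
    ∫ x, ∫ u, (transitionMean P f m u - transitionMean P f (m + k) x) ^ 2 ∂((P ^ k) x) ∂μ =
      ∫ x, transitionMean P f m x ^ 2 ∂μ - ∫ x, transitionMean P f (m + k) x ^ 2 ∂μ := by
  have hsq : ∀ n, Measurable fun u => transitionMean P f n u ^ 2 :=
    fun n => (measurable_transitionMean P hf n).pow_const 2
  have hsqb : ∀ n u, |transitionMean P f n u ^ 2| ≤ C ^ 2 := fun n u => by
    rw [abs_pow]
    exact pow_le_pow_left₀ (abs_nonneg _) (abs_transitionMean_le P hC n u) 2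
  simp_rw [integral_sq_sub_transitionMean hf hC]
  have i1 : Integrable (transitionMean P (fun u => transitionMean P f m u ^ 2) k) μ :=
    integrable_of_abs_le (measurable_transitionMean P (hsq m) k)
      (abs_transitionMean_le P (hsqb m) k)
  have i2 : Integrable (fun u => transitionMean P f (m + k) u ^ 2) μ :=
    integrable_of_abs_le (hsq _) (hsqb _)
  refine ⟨i1.sub i2, ?_⟩
  rw [integral_sub i1 i2, integral_transitionMean hμ (hsq m) (hsqb m)]

lemma antitone_integral_sq_transitionMean (hμ : Kernel.Invariant P μ) {f : E → ℝ}
    (hf : Measurable f) {C : ℝ} (hC : ∀ x, |f x| ≤ C) :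
    Antitone fun n => ∫ x, transitionMean P f n x ^ 2 ∂μ := by
  refine antitone_nat_of_succ_le fun n => sub_nonneg.1 ?_
  rw [← (integral_integral_sq_sub_transitionMean hμ hf hC n 1).2]
  exact integral_nonneg fun x => integral_nonneg fun u => sq_nonneg _

/-- For large `m` and all `k`, for most starting points `x`, the chain at time `k` lies in a fixed
compact set and `P ^ m f` takes there a value close to `(P ^ (m + k) f) x`, with high probability.
-/
lemma exists_transitionMean_concentrated [TopologicalSpace E] [PolishSpace E] [BorelSpace E]
    (hμ : Kernel.Invariant P μ) {f : E → ℝ} (hf : Measurable f) {C : ℝ} (hC : ∀ x, |f x| ≤ C)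
    {η : ℝ} (hη : 0 < η) {δ θ : ℝ} (hδ : 0 < δ) (hθ : 0 < θ) :
    ∃ K : Set E, IsCompact K ∧ ∃ m : ℕ, ∀ k : ℕ,
      μ {x | ENNReal.ofReal δ ≤ (P ^ k) x
        (Kᶜ ∪ {u | η < |transitionMean P f m u - transitionMean P f (m + k) x|})} ≤
        ENNReal.ofReal θ := by
  -- By invariance `P ^ k x Kᶜ` has `μ`-mean `μ Kᶜ` for every `k`; Markov's inequality at level `δ /
  -- 3` then loses at most `θ / 2`.
  obtain ⟨K, hK, hKμ⟩ := isTightMeasureSet_iff_exists_isCompact_measure_compl_le.1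
    (isTightMeasureSet_singleton (μ := μ)) (ENNReal.ofReal (δ / 3 * (θ / 2)))
    (by simpa using by positivity)
  have hKμ := hKμ μ rfl
  set a : ℕ → ℝ := fun n => ∫ x, transitionMean P f n x ^ 2 ∂μ with ha
  have hanti : Antitone a := antitone_integral_sq_transitionMean hμ hf hC
  have hlim := tendsto_atTop_ciInf hanti ⟨0, by
    rintro _ ⟨n, rfl⟩
    exact integral_nonneg fun x => sq_nonneg _⟩
  -- A variance below `t` gives, by Chebyshev, deviation probability at most `δ / 3`. Choosing `m`
  -- within `t * (θ / 2)` of the infimum bounds the decrement for all `k`.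
  set t : ℝ := δ / 3 * η ^ 2 with ht
  have htpos : 0 < t := by positivity
  obtain ⟨m, hm⟩ := (hlim.eventually
    (gt_mem_nhds (show (⨅ n, a n) < (⨅ n, a n) + t * (θ / 2) by
      linarith [mul_pos htpos (half_pos hθ)]))).exists
  refine ⟨K, hK, m, fun k => ?_⟩
  set V : E → ℝ := fun x =>
    ∫ u, (transitionMean P f m u - transitionMean P f (m + k) x) ^ 2 ∂((P ^ k) x) with hV
  obtain ⟨hVint, hVeq⟩ := integral_integral_sq_sub_transitionMean hμ hf hC m k
  have hV0 : ∀ x, 0 ≤ V x := fun x => integral_nonneg fun u => sq_nonneg _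
  have h1 : μ {x | t ≤ V x} ≤ ENNReal.ofReal (θ / 2) := by
    have h := mul_meas_ge_le_integral_of_nonneg (ae_of_all μ hV0) hVint t
    rw [← ofReal_measureReal]
    refine ENNReal.ofReal_le_ofReal ?_
    rw [hVeq] at h
    have h2 : (⨅ n, a n) ≤ a (m + k) :=
      hanti.le_of_tendsto hlim (m + k)
    refine le_of_mul_le_mul_left ?_ htpos
    simp only [ha] at h2 hm ⊢
    linarith
  have h2 : μ {x | ENNReal.ofReal (δ / 3) ≤ (P ^ k) x Kᶜ} ≤ ENNReal.ofReal (θ / 2) := by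
    have hKm : MeasurableSet Kᶜ := hK.isClosed.measurableSet.compl
    have h := mul_meas_ge_le_lintegral (μ := μ) ((P ^ k).measurable_coe hKm)
      (ENNReal.ofReal (δ / 3))
    rw [← Measure.bind_apply hKm (P ^ k).measurable.aemeasurable, invariant_pow hμ k] at h
    have h3 := h.trans hKμ
    rw [ENNReal.ofReal_mul (by positivity)] at h3
    exact (ENNReal.mul_le_mul_iff_right (by simpa using by positivity) ENNReal.ofReal_ne_top).1 h3
  calc _ ≤ μ ({x | t ≤ V x} ∪ {x | ENNReal.ofReal (δ / 3) ≤ (P ^ k) x Kᶜ}) := by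
        refine measure_mono fun x hx => ?_
        by_contra hnot
        simp only [Set.mem_union, Set.mem_ofPred_eq, not_or, not_le] at hnot
        have hc := measure_lt_abs_le ((P ^ k) x) (η := η)
          (g := fun u => transitionMean P f m u - transitionMean P f (m + k) x)
          (integrable_of_abs_le (C := (C + C) ^ 2)
            (((measurable_transitionMean P hf m).sub_const _).pow_const 2) fun u => by
              rw [abs_pow]
              exact pow_le_pow_left₀ (abs_nonneg _) ((abs_sub _ _).trans
                (add_le_add (abs_transitionMean_le P hC _ _)
                  (abs_transitionMean_le P hC _ _))) 2) hη
        have hle : V x / η ^ 2 ≤ δ / 3 := by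
          rw [div_le_iff₀ (by positivity)]
          exact hnot.1.le
        have htot := (measure_union_le _ _).trans
          (add_le_add hnot.2.le (hc.trans (ENNReal.ofReal_le_ofReal hle)))
        have hx' := le_trans hx htot
        rw [← ENNReal.ofReal_add (by positivity) (by positivity),
          ENNReal.ofReal_le_ofReal_iff (by positivity)] at hx'
        linarith
    _ ≤ ENNReal.ofReal (θ / 2) + ENNReal.ofReal (θ / 2) :=
        (measure_union_le _ _).trans (add_le_add h1 h2)
    _ = ENNReal.ofReal θ := by
        rw [← ENNReal.ofReal_add (by positivity) (by positivity), add_halves]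

end Mean

/-! ### Convergence against test functions. -/

section Convergence

variable {E : Type*} [MeasurableSpace E]

/-- From time `N` on, two copies of the chain started from the pair `p` can be found at distance at
most `ε` from each other outside of any two events of probability less than `δ`. -/
def CloseOutsideSmall (P : Kernel E E) (d : E → E → ℝ) (δ : ℝ≥0∞) (ε : ℝ) (N : ℕ)
    (p : E × E) : Prop :=
  ∀ k ≥ N, ∀ A B : Set E, MeasurableSet A → MeasurableSet B →
    (P ^ k) p.1 A < δ → (P ^ k) p.2 B < δ → ∃ u ∉ A, ∃ v ∉ B, d u v ≤ ε

lemma CloseOutsideSmall.mono {P : Kernel E E} {d : E → E → ℝ} {δ δ' : ℝ≥0∞} {ε : ℝ} {N N' : ℕ}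
    {p : E × E} (h : CloseOutsideSmall P d δ ε N p) (hδ : δ' ≤ δ) (hN : N ≤ N') :
    CloseOutsideSmall P d δ' ε N' p :=
  fun k hk A B hA hB h1 h2 => h k (hN.trans hk) A B hA hB (h1.trans_le hδ) (h2.trans_le hδ)

lemma exists_ofReal_one_div_lt {δ : ℝ≥0∞} (hδ : 0 < δ) :
    ∃ i : ℕ, ENNReal.ofReal (1 / ((i : ℝ) + 1)) < δ := by
  have h := ENNReal.tendsto_ofReal (tendsto_one_div_add_atTop_nhds_zero_nat (𝕜 := ℝ))
  rw [ENNReal.ofReal_zero] at h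
  exact (h.eventually (gt_mem_nhds hδ)).exists

variable [TopologicalSpace E] [PolishSpace E] [BorelSpace E] {d : E → E → ℝ}
  {P : Kernel E E} [IsMarkovKernel P] {μ : Measure E} [IsProbabilityMeasure μ]

/-- At suitable times, `P ^ n f` takes close values at most pairs of starting points. -/
lemma exists_transitionMean_close (hd : IsBoundedContinuousMetric d) (hP : DFeller d P)
    (hμ : Kernel.Invariant P μ) {M : Set (E × E)} (hM : (μ.prod μ) M = 1)
    (hclose : ∀ p ∈ M, ∃ δ : ℝ≥0∞, 0 < δ ∧ ∀ ε : ℝ, 0 < ε → ∃ N, CloseOutsideSmall P d δ ε N p)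
    {f : E → ℝ} (hfd : DContinuous d f) {C : ℝ} (hC : ∀ x, |f x| ≤ C)
    {η : ℝ} (hη : 0 < η) {θ : ℝ} (hθ : 0 < θ) :
    ∃ n, (μ.prod μ).real
      {p | 3 * η < |transitionMean P f n p.1 - transitionMean P f n p.2|} ≤ 3 * θ := by
  have hf : Measurable f := (hd.continuous_of_dContinuous hfd).measurable
  let δ : ℕ → ℝ := fun i => 1 / ((i : ℝ) + 1)
  have hδ : ∀ i, 0 < δ i := fun i => Nat.one_div_pos_of_nat
  have hδanti : Antitone δ := fun i j hij => Nat.one_div_le_one_div hij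
  let S : ℕ → Set (E × E) := fun i => {p | p ∈ M ∧
    ∀ ε : ℝ, 0 < ε → ∃ N, CloseOutsideSmall P d (ENNReal.ofReal (δ i)) ε N p}
  have hSmono : Monotone S := fun i j hij p hp => ⟨hp.1, fun ε hε => by
    obtain ⟨N, hN⟩ := hp.2 ε hε
    exact ⟨N, hN.mono (ENNReal.ofReal_le_ofReal (hδanti hij)) le_rfl⟩⟩
  have hSU : ⋃ i, S i = M := by
    refine Set.Subset.antisymm (Set.iUnion_subset fun i p hp => hp.1) fun p hp => ?_
    obtain ⟨δ₀, hδ₀, H⟩ := hclose p hp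
    obtain ⟨i, hi⟩ := exists_ofReal_one_div_lt hδ₀
    refine Set.mem_iUnion.2 ⟨i, hp, fun ε hε => ?_⟩
    obtain ⟨N, hN⟩ := H ε hε
    exact ⟨N, hN.mono hi.le le_rfl⟩
  have hlt : ENNReal.ofReal (1 - θ) < 1 := by
    rw [ENNReal.ofReal_lt_one]
    linarith
  -- Continuity from below along monotone unions needs no measurability of the sets `S i`.
  have hSlim := tendsto_measure_iUnion_atTop (μ := μ.prod μ) hSmono
  rw [hSU, hM] at hSlim
  obtain ⟨i, hi⟩ := (hSlim.eventually (lt_mem_nhds hlt)).exists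
  -- The order of choices matters: `i` fixes `K` and `m`, these fix `ε`, and `ε` fixes `N`. As
  -- `hconc` holds for all `k`, it may be used at `k = N`.
  obtain ⟨K, hK, m, hconc⟩ := exists_transitionMean_concentrated hμ hf hC hη (hδ i) hθ
  have hmd := dContinuous_transitionMean P hP hf hC hfd m
  obtain ⟨ε, hε, hunif⟩ := hd.exists_uniform_of_isCompact hmd hK hη
  let R : ℕ → Set (E × E) := fun N =>
    {p | p ∈ S i ∧ CloseOutsideSmall P d (ENNReal.ofReal (δ i)) ε N p}
  have hRmono : Monotone R := fun N N' hN p hp => ⟨hp.1, hp.2.mono le_rfl hN⟩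
  have hRU : ⋃ N, R N = S i := by
    refine Set.Subset.antisymm (Set.iUnion_subset fun N p hp => hp.1) fun p hp => ?_
    obtain ⟨N, hN⟩ := hp.2 ε hε
    exact Set.mem_iUnion.2 ⟨N, hp, hN⟩
  have hRlim := tendsto_measure_iUnion_atTop (μ := μ.prod μ) hRmono
  rw [hRU] at hRlim
  obtain ⟨N, hN⟩ := (hRlim.eventually (lt_mem_nhds hi)).exists
  have hmm := measurable_transitionMean P hf m
  have hmn := measurable_transitionMean P hf (m + N)
  let A : E → Set E := fun x =>
    Kᶜ ∪ {u | η < |transitionMean P f m u - transitionMean P f (m + N) x|}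
  have hA : ∀ x, MeasurableSet (A x) := fun x => hK.isClosed.measurableSet.compl.union
    (measurableSet_lt measurable_const (hmm.sub_const _).abs)
  let B : Set E := {x | ENNReal.ofReal (δ i) ≤ (P ^ N) x (A x)}
  have hB : μ B ≤ ENNReal.ofReal θ := hconc N
  set G : Set (E × E) :=
    {p | 3 * η < |transitionMean P f (m + N) p.1 - transitionMean P f (m + N) p.2|} with hG
  have hGm : MeasurableSet G := measurableSet_lt measurable_const
    ((hmn.comp measurable_fst).sub (hmn.comp measurable_snd)).abs
  refine ⟨m + N, ?_⟩
  -- For good starting points the values at `x`, `u`, `v`, `y` differ successively by at most `η`,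
  -- which accounts for `3 * η`.
  have hsub : R N ⊆ (B ×ˢ Set.univ ∪ Set.univ ×ˢ B) ∪ Gᶜ := by
    rintro ⟨x, y⟩ ⟨-, hxy⟩
    by_contra hnot
    simp only [Set.mem_union, Set.mem_prod, Set.mem_univ, and_true, true_and, not_or,
      Set.mem_compl_iff, not_not] at hnot
    obtain ⟨⟨hxB, hyB⟩, hxyG⟩ := hnot
    obtain ⟨u, hu, v, hv, huv⟩ :=
      hxy N le_rfl (A x) (A y) (hA x) (hA y) (not_le.1 hxB) (not_le.1 hyB)
    simp only [A, Set.mem_union, Set.mem_compl_iff, Set.mem_ofPred_eq, not_or, not_not,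
      not_lt] at hu hv
    have h1 := abs_le.1 (hunif u hu.1 v hv.1 huv)
    have h2 := abs_le.1 hu.2
    have h3 := abs_le.1 hv.2
    have hlt : 3 * η < |transitionMean P f (m + N) x - transitionMean P f (m + N) y| := hxyG
    exact absurd hlt (not_lt.2 (abs_le.2 ⟨by linarith, by linarith⟩))
  have hle : (μ.prod μ) (R N) ≤ ENNReal.ofReal (θ + θ + (μ.prod μ).real Gᶜ) := by
    rw [ENNReal.ofReal_add (by positivity) measureReal_nonneg,
      ENNReal.ofReal_add hθ.le hθ.le, ofReal_measureReal]
    refine (measure_mono hsub).trans ((measure_union_le _ _).trans ?_)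
    gcongr
    refine (measure_union_le _ _).trans ?_
    rw [Measure.prod_prod, Measure.prod_prod, measure_univ, mul_one, one_mul]
    gcongr
  have hfin := lt_of_lt_of_le hN hle
  have hpos : 0 < θ + θ + (μ.prod μ).real Gᶜ :=
    add_pos_of_pos_of_nonneg (by positivity) measureReal_nonneg
  rw [ENNReal.ofReal_lt_ofReal_iff hpos, probReal_compl_eq_one_sub hGm] at hfin
  linarith

/-- Convergence of the transition probabilities tested against a bounded `d`-continuous function.
-/
lemma tendsto_measure_transitionMean_sub (hd : IsBoundedContinuousMetric d) (hP : DFeller d P)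
    (hμ : Kernel.Invariant P μ) {M : Set (E × E)} (hM : (μ.prod μ) M = 1)
    (hclose : ∀ p ∈ M, ∃ δ : ℝ≥0∞, 0 < δ ∧ ∀ ε : ℝ, 0 < ε → ∃ N, CloseOutsideSmall P d δ ε N p)
    {f : E → ℝ} (hfd : DContinuous d f) {C : ℝ} (hC : ∀ x, |f x| ≤ C) {η : ℝ} (hη : 0 < η) :
    Tendsto (fun n => μ {x | η < |transitionMean P f n x - ∫ y, f y ∂μ|}) atTop (𝓝 0) := by
  have hf : Measurable f := (hd.continuous_of_dContinuous hfd).measurable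
  have hm := measurable_transitionMean P hf
  have hb := abs_transitionMean_le P hC
  set c := ∫ y, f y ∂μ with hc
  have hsqb : ∀ n x, |transitionMean P f n x ^ 2| ≤ C ^ 2 := fun n x => by
    rw [abs_pow]
    exact pow_le_pow_left₀ (abs_nonneg _) (hb n x) 2
  set w : ℕ → ℝ := fun n => ∫ x, (transitionMean P f n x - c) ^ 2 ∂μ with hw
  have hw0 : ∀ n, 0 ≤ w n := fun n => integral_nonneg fun x => sq_nonneg _
  have hweq : ∀ n, w n = ∫ x, transitionMean P f n x ^ 2 ∂μ - c ^ 2 := fun n => by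
    simp only [hw]
    rw [integral_sub_const_sq (hm n) (hb n), integral_transitionMean hμ hf hC, ← hc]
    ring
  have hanti : Antitone w := fun n n' h => by
    rw [hweq, hweq]
    exact sub_le_sub_right (antitone_integral_sq_transitionMean hμ hf hC h) _
  -- Twice the variance is the mean squared difference of two independent copies, split according to
  -- whether they differ by more than `ρ`.
  have hwG : ∀ n, ∀ ρ : ℝ, 0 ≤ ρ → 2 * w n ≤ ρ ^ 2 + (C + C) ^ 2 * (μ.prod μ).real
      {p | ρ < |transitionMean P f n p.1 - transitionMean P f n p.2|} := by
    intro n ρ hρ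
    set G : Set (E × E) := {p | ρ < |transitionMean P f n p.1 - transitionMean P f n p.2|}
    have hm1 : Measurable fun p : E × E => transitionMean P f n p.1 := (hm n).comp measurable_fst
    have hm2 : Measurable fun p : E × E => transitionMean P f n p.2 := (hm n).comp measurable_snd
    have hGm : MeasurableSet G := measurableSet_lt measurable_const (hm1.sub hm2).abs
    have hdiff : ∀ p : E × E, |transitionMean P f n p.1 - transitionMean P f n p.2| ≤ C + C :=
      fun p => (abs_sub _ _).trans (add_le_add (hb n _) (hb n _))
    have hint : Integrable
        (fun p : E × E => (transitionMean P f n p.1 - transitionMean P f n p.2) ^ 2)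
        (μ.prod μ) := integrable_of_abs_le (C := (C + C) ^ 2) ((hm1.sub hm2).pow_const 2)
      fun p => by
        rw [abs_pow]
        exact pow_le_pow_left₀ (abs_nonneg _) (hdiff p) 2
    have heq : ∫ p : E × E, (transitionMean P f n p.1 - transitionMean P f n p.2) ^ 2
        ∂(μ.prod μ) = 2 * w n := by
      rw [integral_prod_symm _ hint]
      simp_rw [integral_sub_const_sq (hm n) (hb n), integral_transitionMean hμ hf hC, ← hc]
      have i1 : Integrable (fun y => 2 * transitionMean P f n y * c) μ :=
        ((integrable_of_abs_le (hm n) (hb n)).const_mul 2).mul_const c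
      have i2 : Integrable (fun y => transitionMean P f n y ^ 2) μ :=
        integrable_of_abs_le ((hm n).pow_const 2) (hsqb n)
      have i3 : Integrable (fun y => (∫ u, transitionMean P f n u ^ 2 ∂μ) -
        2 * transitionMean P f n y * c) μ := (integrable_const _).sub i1
      rw [integral_add i3 i2, integral_sub (integrable_const _) i1, integral_const,
        probReal_univ, one_smul, integral_mul_const, integral_const_mul,
        integral_transitionMean hμ hf hC, ← hc, hweq]
      ring
    rw [← heq]
    have hGi : Integrable (G.indicator fun _ => (C + C) ^ 2) (μ.prod μ) :=
      (integrable_const _).indicator hGm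
    calc _ ≤ ∫ p, ρ ^ 2 + G.indicator (fun _ => (C + C) ^ 2) p ∂(μ.prod μ) := by
          refine integral_mono hint ((integrable_const _).add hGi) fun p => ?_
          by_cases hp : p ∈ G
          · simp only [Set.indicator_of_mem hp]
            have := pow_le_pow_left₀ (abs_nonneg _) (hdiff p) 2
            rw [sq_abs] at this
            linarith [sq_nonneg ρ]
          · simp only [Set.indicator_of_notMem hp, add_zero]
            rw [← sq_abs]
            exact pow_le_pow_left₀ (abs_nonneg _) (not_lt.1 hp) 2
      _ = _ := by
          rw [integral_add (integrable_const _) hGi, integral_const, probReal_univ, one_smul,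
            integral_indicator_const _ hGm, smul_eq_mul, mul_comm]
  have hwlim : Tendsto w atTop (𝓝 0) := by
    refine tendsto_order.2 ⟨fun b hb0 => Eventually.of_forall fun n => hb0.trans_le (hw0 n),
      fun b hb0 => ?_⟩
    have hD : 0 < (C + C) ^ 2 + 1 := by positivity
    -- With `ρ = √b` both terms of `hwG` are at most `b`, the second strictly; one such `n` suffices
    -- since `w` is antitone.
    obtain ⟨n, hn⟩ := exists_transitionMean_close hd hP hμ hM hclose hfd hC
      (η := Real.sqrt b / 3) (by positivity) (θ := b / (3 * ((C + C) ^ 2 + 1))) (by positivity)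
    rw [mul_div_cancel₀ _ (by norm_num : (3 : ℝ) ≠ 0)] at hn
    have h := hwG n (Real.sqrt b) (Real.sqrt_nonneg _)
    rw [Real.sq_sqrt hb0.le] at h
    have h3 : (C + C) ^ 2 * (3 * (b / (3 * ((C + C) ^ 2 + 1)))) < b := by
      rw [show (C + C) ^ 2 * (3 * (b / (3 * ((C + C) ^ 2 + 1)))) =
        (C + C) ^ 2 * b / ((C + C) ^ 2 + 1) by field_simp, div_lt_iff₀ hD]
      linarith
    have h4 := mul_le_mul_of_nonneg_left hn (sq_nonneg (C + C))
    filter_upwards [eventually_ge_atTop n] with k hk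
    have := hanti hk
    linarith
  have hbound : ∀ n, μ {x | η < |transitionMean P f n x - c|} ≤ ENNReal.ofReal (w n / η ^ 2) :=
    fun n => measure_lt_abs_le μ (g := fun x => transitionMean P f n x - c)
      (integrable_of_abs_le (C := (C + |c|) ^ 2) (((hm n).sub_const c).pow_const 2) fun x => by
        rw [abs_pow]
        exact pow_le_pow_left₀ (abs_nonneg _)
          ((abs_sub _ _).trans (add_le_add (hb n x) le_rfl)) 2) hη
  refine tendsto_of_tendsto_of_tendsto_of_le_of_le tendsto_const_nhds ?_ (fun _ => zero_le) hbound
  have h := ENNReal.tendsto_ofReal (hwlim.div_const (η ^ 2))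
  rwa [zero_div, ENNReal.ofReal_zero] at h

end Convergence

end GenCoupling

/-! ### From test functions to the coupling distance. -/

open GenCoupling in
theorem corollary2p4
    {E : Type*} [TopologicalSpace E] [PolishSpace E] [MeasurableSpace E] [BorelSpace E]
    (d : E → E → ℝ) (hd : GenCoupling.IsBoundedContinuousMetric d)
    (P : Kernel E E) [IsMarkovKernel P] (hP : GenCoupling.DFeller d P)
    (μ : Measure E) [IsProbabilityMeasure μ] (hμ : GenCoupling.IsErgodicInvariant P μ)
    (M : Set (E × E)) (hM : MeasurableSet M) (hμM : (μ.prod μ) M = 1)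
    (hξ : ∀ x y : E, (x, y) ∈ M →
      ∃ ξ ∈ GenCoupling.generalizedCouplings
          (GenCoupling.chainLaw P (Measure.dirac x)) (GenCoupling.chainLaw P (Measure.dirac y)),
        ∃ α : ℝ, 0 < α ∧ ∀ ε : ℝ, 0 < ε →
          ENNReal.ofReal α ≤
            liminf (fun n : ℕ => ξ {z : (ℕ → E) × (ℕ → E) | d (z.1 n) (z.2 n) ≤ ε}) atTop) :
    ∀ ε : ℝ, 0 < ε →
      Tendsto
        (fun n : ℕ => μ {x : E | ENNReal.ofReal ε < GenCoupling.couplingDist d ((P ^ n) x) μ})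
        atTop (𝓝 0) := by
  intro ε hε
  have hclose : ∀ p ∈ M, ∃ δ : ℝ≥0∞, 0 < δ ∧
      ∀ ε : ℝ, 0 < ε → ∃ N, CloseOutsideSmall P d δ ε N p := by
    rintro ⟨x, y⟩ hp
    obtain ⟨ξ, hξ, α, hα, hlim⟩ := hξ x y hp
    exact exists_close_of_generalizedCoupling P hξ hα hlim
  obtain ⟨C₀, hC₀⟩ := hd.bounded
  set C := max C₀ 1 with hCdef
  have hC : ∀ x y, d x y ≤ C := fun x y => (hC₀ x y).trans (le_max_left _ _)
  have hCpos : 0 < C := zero_lt_one.trans_le (le_max_right _ _)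
  -- Half of `ε` pays for the matched pieces, in balls of radius `ε / 4`. The other half is `C * (2
  -- * δ)`: one `δ` for mass missed by the partition, one for the total error `r * η`.
  set δ := ε / (4 * C) with hδdef
  have hδ : 0 < δ := by positivity
  obtain ⟨r, z, φ, hφ0, hφ1, hφd, hφsum, hφsupp, hφμ⟩ :=
    hd.exists_partition μ (ε := ε / 4) (by positivity) hδ
  have hφm : ∀ i, Measurable (φ i) := fun i => (hd.continuous_of_dContinuous (hφd i)).measurable
  have hφabs : ∀ i x, |φ i x| ≤ 1 := fun i x => by
    rw [abs_of_nonneg (hφ0 i x)]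
    exact hφ1 i x
  set η := δ / (r + 1) with hηdef
  have hη : 0 < η := by positivity
  have hlint : ∀ (ν : Measure E) [IsProbabilityMeasure ν] (i : ℕ),
      ∫⁻ x, ENNReal.ofReal (φ i x) ∂ν = ENNReal.ofReal (∫ x, φ i x ∂ν) := fun ν _ i =>
    (ofReal_integral_eq_lintegral_ofReal (integrable_of_abs_le (hφm i) (hφabs i))
      (ae_of_all _ (hφ0 i))).symm
  have hdist : ∀ n x, (∀ i < r, |transitionMean P (φ i) n x - ∫ y, φ i y ∂μ| ≤ η) →
      couplingDist d ((P ^ n) x) μ ≤ ENNReal.ofReal ε := by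
    intro n x hx
    refine (couplingDist_le_of_partition hd.symm hd.triangle hC ((P ^ n) x) μ (Finset.range r) z
      (fun i y => ENNReal.ofReal (φ i y)) (fun i => (hφm i).ennreal_ofReal) (fun y => ?_)
      (ε := ε / 4) (fun i y hy => hφsupp i y fun h => hy (by simp [h]))).trans ?_
    · rw [← ENNReal.ofReal_sum_of_nonneg fun i _ => hφ0 i y]
      exact ENNReal.ofReal_le_one.2 (hφsum y)
    · have hmin : ∀ i, 0 ≤ min (transitionMean P (φ i) n x) (∫ y, φ i y ∂μ) := fun i =>
        le_min (integral_nonneg (hφ0 i)) (integral_nonneg (hφ0 i))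
      have hsumη : ∑ i ∈ Finset.range r, ((∫ y, φ i y ∂μ) - η) ≤
          ∑ i ∈ Finset.range r, min (transitionMean P (φ i) n x) (∫ y, φ i y ∂μ) :=
        Finset.sum_le_sum fun i hi => by
          have := abs_le.1 (hx i (Finset.mem_range.1 hi))
          exact le_min (by linarith) (by linarith)
      rw [Finset.sum_sub_distrib, Finset.sum_const, Finset.card_range, nsmul_eq_mul] at hsumη
      have hrη : r * η ≤ δ := by
        rw [hηdef, mul_div_assoc', div_le_iff₀ (by positivity)]
        linarith
      simp_rw [hlint]
      change ENNReal.ofReal (2 * (ε / 4)) + ENNReal.ofReal C * (1 - ∑ i ∈ Finset.range r,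
        min (ENNReal.ofReal (transitionMean P (φ i) n x)) (ENNReal.ofReal (∫ y, φ i y ∂μ))) ≤ _
      simp_rw [← ENNReal.ofReal_min]
      rw [← ENNReal.ofReal_sum_of_nonneg fun i _ => hmin i, ← ENNReal.ofReal_one,
        ← ENNReal.ofReal_sub _ (Finset.sum_nonneg fun i _ => hmin i),
        ← ENNReal.ofReal_mul hCpos.le]
      have h2 : C * (1 - ∑ i ∈ Finset.range r,
          min (transitionMean P (φ i) n x) (∫ y, φ i y ∂μ)) ≤ C * (2 * δ) := by
        gcongr
        linarith
      have h3 : C * (2 * δ) = ε / 2 := by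
        rw [hδdef]
        field_simp
        norm_num
      refine (add_le_add le_rfl (ENNReal.ofReal_le_ofReal (h2.trans h3.le))).trans ?_
      rw [← ENNReal.ofReal_add (by positivity) (by positivity)]
      exact ENNReal.ofReal_le_ofReal (by linarith)
  have hlim : Tendsto (fun n => ∑ i ∈ Finset.range r,
      μ {x | η < |transitionMean P (φ i) n x - ∫ y, φ i y ∂μ|}) atTop (𝓝 0) := by
    have h := tendsto_finsetSum (Finset.range r) fun i _ =>
      tendsto_measure_transitionMean_sub hd hP hμ.1 hμM hclose (hφd i) (hφabs i) hη
    rwa [Finset.sum_const_zero] at h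
  -- By `hdist`, a large coupling distance forces one of the finitely many test functions to
  -- deviate; a union bound concludes.
  refine tendsto_of_tendsto_of_tendsto_of_le_of_le tendsto_const_nhds hlim (fun _ => zero_le)
    fun n => ?_
  refine (measure_mono fun x hx => ?_).trans (measure_biUnion_finset_le _ _)
  by_contra hnot
  simp only [Set.mem_iUnion, Finset.mem_range, Set.mem_ofPred_eq, not_exists, not_lt] at hnot
  exact absurd hx (not_lt.2 (hdist n x hnot))
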